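/- Let $\mathcal W_n$ be the Weyl algebra, i.e. the complex unital $*$-algebra generated by $a_1,\dots,a_n,a_1^*,\dots,a_n^*$ with relations $[a_i,a_j]=[a_i^*,a_j^*]=0$, $[a_i,a_j^*]=\delta_{ij}$. Every $p\in\mathcal W_n$ has a unique normal form $p=\sum_{s,t}p_{s,t}(a^*)^s a^t$ with $s,t\in\mathbb N^n$, and $\deg p=\max\{\|s\|_1+\|t\|_1: p_{s,t}\neq0\}$ (with $\deg 0=0$). Let $p=p^*\in\mathcal W_n$ and let $k\in\mathbb N$ satisfy $2k\ge\deg p$. Consider the following two pairs of programs. SOS programs: $$\lambda^k=\sup\{\lambda\in\mathbb R:\ p-\lambda\in\Sigma^2_k\},\qquad \max\{\lambda\in\mathbb R:\ p-\lambda=(w^k)^*Zw^k,\ Z\ge0\}, \tag{SOS}$$ where $\Sigma_k^2$ is the set of finite sums $\sum_i f_i^*f_i$ with $\deg f_i\le k$, $w^k$ is the vector of the normally ordered monomials $(a^*)^sa^t$ of degree at most $k$, and $Z$ ranges over complex positive semidefinite matrices. Moment programs: $$\mu^k=\inf\{L(p):\ L(1)=1,\ L(qq^*)\ge0\ \text{for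 all } q\in\mathcal W_n,\ \deg q\le k\},\qquad \inf\Big\{\sum_{s,t}p_{s,t}y_{s,t}:\ y_{0,0}=1,\ M_k(y)\ge0\Big\}, \tag{M}$$ where $L$ ranges over the linear functionals $\mathcal W_n\to\mathbb C$, $y=(y_{s,t})_{\|s+t\|_1\le2k}$ over families of complex numbers, and the moment matrix $M_k(y)$, with rows and columns indexed by the pairs $(s,t)$ with $\|s+t\|_1\le k$, has entries $[M_k(y)]_{(s,t),(u,v)}=\sum_{q,r}c_{q,r}\,y_{q,r}$, where $\sum_{q,r}c_{q,r}(a^*)^qa^r$ is the normal form of $((a^*)^sa^t)^*(a^*)^ua^v$. Lemma. If the semidefinite SOS program (the second one in (SOS)) has a feasible point $(\lambda,Z)$, then there is no duality gap, $\mu^k=\lambda^k$. More precisely, there is a real number $v$ that is the supremum of the first program in (SOS), the attained maximum of the second one, and the infimum of each of the two programs in (M). -/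

import Mathlib

open scoped ComplexOrder

noncomputable section

namespace WeylOpt

/-! ### The Weyl algebra -/

/-- The `2n` letters `a_i` (annihilation) and `a_i^*` (creation). -/
inductive Letter (n : ℕ) : Type
  | ann (i : Fin n) : Letter n
  | cre (i : Fin n) : Letter n

/-- The canonical commutation relations
`[a_i, a_j] = [a_i^*, a_j^*] = 0`, `[a_i, a_j^*] = δ_ij`. -/
inductive CCR (n : ℕ) : FreeAlgebra ℂ (Letter n) → FreeAlgebra ℂ (Letter n) → Prop
  | ann_ann (i j : Fin n) :
      CCR n (FreeAlgebra.ι ℂ (Letter.ann i) * FreeAlgebra.ι ℂ (Letter.ann j))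
        (FreeAlgebra.ι ℂ (Letter.ann j) * FreeAlgebra.ι ℂ (Letter.ann i))
  | cre_cre (i j : Fin n) :
      CCR n (FreeAlgebra.ι ℂ (Letter.cre i) * FreeAlgebra.ι ℂ (Letter.cre j))
        (FreeAlgebra.ι ℂ (Letter.cre j) * FreeAlgebra.ι ℂ (Letter.cre i))
  | ann_cre (i j : Fin n) :
      CCR n (FreeAlgebra.ι ℂ (Letter.ann i) * FreeAlgebra.ι ℂ (Letter.cre j))
        (FreeAlgebra.ι ℂ (Letter.cre j) * FreeAlgebra.ι ℂ (Letter.ann i)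
          + if i = j then 1 else 0)

/-- The Weyl algebra `W_n`: the complex algebra generated by the letters `a_i`, `a_i^*` subject to
the canonical commutation relations. -/
def Weyl (n : ℕ) : Type := RingQuot (CCR n)

instance (n : ℕ) : Ring (Weyl n) := inferInstanceAs (Ring (RingQuot (CCR n)))

instance (n : ℕ) : Algebra ℂ (Weyl n) := inferInstanceAs (Algebra ℂ (RingQuot (CCR n)))

variable {n : ℕ}

/-- The quotient map from the free algebra. -/
def proj (n : ℕ) : FreeAlgebra ℂ (Letter n) →ₐ[ℂ] Weyl n := RingQuot.mkAlgHom ℂ (CCR n)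

/-- The generator `a_i`. -/
def ann (i : Fin n) : Weyl n := proj n (FreeAlgebra.ι ℂ (Letter.ann i))

/-- The generator `a_i^*`. -/
def cre (i : Fin n) : Weyl n := proj n (FreeAlgebra.ι ℂ (Letter.cre i))

theorem ann_mul_ann (i j : Fin n) : ann i * ann j = ann j * ann i := by
  have h := RingQuot.mkAlgHom_rel ℂ (CCR.ann_ann i j)
  rw [map_mul, map_mul] at h
  exact h

theorem cre_mul_cre (i j : Fin n) : cre i * cre j = cre j * cre i := by
  have h := RingQuot.mkAlgHom_rel ℂ (CCR.cre_cre i j)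
  rw [map_mul, map_mul] at h
  exact h

theorem ann_mul_cre (i j : Fin n) :
    ann i * cre j = cre j * ann i + if i = j then 1 else 0 := by
  have h := RingQuot.mkAlgHom_rel ℂ (CCR.ann_cre i j)
  rw [map_mul, map_add, map_mul, apply_ite (RingQuot.mkAlgHom ℂ (CCR n)), map_one, map_zero] at h
  exact h

theorem proj_surjective (n : ℕ) : Function.Surjective (proj n) :=
  RingQuot.mkAlgHom_surjective ℂ (CCR n)

theorem Weyl.induction {P : Weyl n → Prop} (hC : ∀ c : ℂ, P (algebraMap ℂ _ c))
    (hann : ∀ i, P (ann i)) (hcre : ∀ i, P (cre i))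
    (hmul : ∀ x y, P x → P y → P (x * y)) (hadd : ∀ x y, P x → P y → P (x + y))
    (x : Weyl n) : P x := by
  obtain ⟨y, rfl⟩ := proj_surjective n x
  induction y using FreeAlgebra.induction with
  | grade0 r => simpa using hC r
  | grade1 l =>
    cases l with
    | ann i => exact hann i
    | cre i => exact hcre i
  | mul a b ha hb => simpa using hmul _ _ ha hb
  | add a b ha hb => simpa using hadd _ _ ha hb

/-- The universal property of the Weyl algebra. -/
def lift {A : Type*} [Ring A] [Algebra ℂ A] (f : Letter n → A)
    (h1 : ∀ i j, f (.ann i) * f (.ann j) = f (.ann j) * f (.ann i))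
    (h2 : ∀ i j, f (.cre i) * f (.cre j) = f (.cre j) * f (.cre i))
    (h3 : ∀ i j, f (.ann i) * f (.cre j) = f (.cre j) * f (.ann i) + if i = j then 1 else 0) :
    Weyl n →ₐ[ℂ] A :=
  RingQuot.liftAlgHom ℂ ⟨FreeAlgebra.lift ℂ f, by
    intro x y hxy
    cases hxy with
    | ann_ann i j => simpa using h1 i j
    | cre_cre i j => simpa using h2 i j
    | ann_cre i j =>
      rw [map_mul, map_add, map_mul, apply_ite (FreeAlgebra.lift ℂ f), map_one, map_zero]
      simpa using h3 i j⟩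

theorem lift_proj {A : Type*} [Ring A] [Algebra ℂ A] (f : Letter n → A) (h1 h2 h3) (l : Letter n) :
    lift f h1 h2 h3 (proj n (FreeAlgebra.ι ℂ l)) = f l :=
  (RingQuot.liftAlgHom_mkAlgHom_apply ℂ (FreeAlgebra.lift ℂ f) _ (FreeAlgebra.ι ℂ l)).trans
    (by simp)

/-! ### The involution -/

/-- The opposite of the Weyl algebra with scalars acting through complex conjugation. -/
def ConjOp (n : ℕ) : Type := (Weyl n)ᵐᵒᵖ

instance (n : ℕ) : Ring (ConjOp n) := inferInstanceAs (Ring (Weyl n)ᵐᵒᵖ)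

instance (n : ℕ) : Algebra ℂ (ConjOp n) :=
  RingHom.toAlgebra' ((algebraMap ℂ (Weyl n)ᵐᵒᵖ).comp (starRingEnd ℂ))
    (fun c x => Algebra.commutes (A := (Weyl n)ᵐᵒᵖ) (starRingEnd ℂ c) x)

/-- The involution as an algebra homomorphism into `ConjOp n`. -/
def starHom (n : ℕ) : Weyl n →ₐ[ℂ] ConjOp n :=
  lift (A := ConjOp n)
    (fun l => match l with
      | .ann i => (MulOpposite.op (cre i) : (Weyl n)ᵐᵒᵖ)
      | .cre i => (MulOpposite.op (ann i) : (Weyl n)ᵐᵒᵖ))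
    (fun i j => congrArg MulOpposite.op (cre_mul_cre j i))
    (fun i j => congrArg MulOpposite.op (ann_mul_ann j i))
    (fun i j => by
      have h := congrArg MulOpposite.op (ann_mul_cre j i)
      rw [MulOpposite.op_add, apply_ite MulOpposite.op] at h
      simp only [eq_comm (a := j) (b := i)] at h
      exact h)

/-- The conjugate-linear involution of `W_n` that exchanges `a_i` and `a_i^*`. -/
instance (n : ℕ) : Star (Weyl n) :=
  ⟨fun x => MulOpposite.unop (show (Weyl n)ᵐᵒᵖ from starHom n x)⟩

theorem star_ann (i : Fin n) : star (ann i) = cre i :=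
  congrArg (fun z : (Weyl n)ᵐᵒᵖ => z.unop) (lift_proj (A := ConjOp n) _ _ _ _ (Letter.ann i))

theorem star_cre (i : Fin n) : star (cre i) = ann i :=
  congrArg (fun z : (Weyl n)ᵐᵒᵖ => z.unop) (lift_proj (A := ConjOp n) _ _ _ _ (Letter.cre i))

theorem weyl_star_add (x y : Weyl n) : star (x + y) = star x + star y :=
  congrArg (fun z : (Weyl n)ᵐᵒᵖ => z.unop) (map_add (starHom n) x y)

theorem weyl_star_mul (x y : Weyl n) : star (x * y) = star y * star x :=
  congrArg (fun z : (Weyl n)ᵐᵒᵖ => z.unop) (map_mul (starHom n) x y)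

theorem weyl_star_algebraMap (c : ℂ) :
    star (algebraMap ℂ (Weyl n) c) = algebraMap ℂ (Weyl n) (star c) :=
  congrArg (fun z : (Weyl n)ᵐᵒᵖ => z.unop) ((starHom n).commutes c)

instance (n : ℕ) : StarRing (Weyl n) where
  star_involutive x := by
    induction x using Weyl.induction with
    | hC c => simp [weyl_star_algebraMap]
    | hann i => rw [star_ann, star_cre]
    | hcre i => rw [star_cre, star_ann]
    | hmul x y hx hy => rw [weyl_star_mul, weyl_star_mul, hx, hy]
    | hadd x y hx hy => rw [weyl_star_add, weyl_star_add, hx, hy]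
  star_mul := weyl_star_mul
  star_add := weyl_star_add

instance (n : ℕ) : StarModule ℂ (Weyl n) where
  star_smul c x := by
    rw [Algebra.smul_def, Algebra.smul_def, star_mul, weyl_star_algebraMap, Algebra.commutes]

/-! ### Normal form and degree -/

/-- `x_1 ^ s_1 * ⋯ * x_n ^ s_n`. -/
def multiPow {A : Type*} [Monoid A] (x : Fin n → A) (s : Fin n →₀ ℕ) : A :=
  ((List.finRange n).map fun i => x i ^ s i).prod

/-- The index `(s, t)` of a normally ordered monomial. -/
abbrev Idx (n : ℕ) : Type := (Fin n →₀ ℕ) × (Fin n →₀ ℕ)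

/-- The length `‖s + t‖₁` of a normally ordered monomial. -/
def Idx.len (m : Idx n) : ℕ := m.1.degree + m.2.degree

/-- The normally ordered monomial `(a^*)^s a^t`. -/
def normalMonomial (m : Idx n) : Weyl n := multiPow cre m.1 * multiPow ann m.2

theorem multiPow_zero {A : Type*} [Monoid A] (x : Fin n → A) : multiPow x 0 = 1 := by
  simp [multiPow]

theorem multiPow_succ {A : Type*} [Monoid A] (x : Fin n → A)
    (hx : ∀ i j, x i * x j = x j * x i) (s : Fin n →₀ ℕ) (i : Fin n) :
    multiPow x (s + Finsupp.single i 1) = x i * multiPow x s := by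
  have key : ∀ l : List (Fin n), l.Nodup →
      (l.map fun j => x j ^ (s + Finsupp.single i 1 : Fin n →₀ ℕ) j).prod
        = (if i ∈ l then x i else 1) * (l.map fun j => x j ^ s j).prod := by
    intro l
    induction l with
    | nil => intro _; simp
    | cons j l ih =>
      intro hl
      rw [List.nodup_cons] at hl
      rw [List.map_cons, List.prod_cons, ih hl.2, List.map_cons, List.prod_cons]
      by_cases hij : i = j
      · subst hij
        simp [hl.1, pow_succ', mul_assoc]
      · have hc : Commute (x i) (x j ^ s j) := Commute.pow_right (hx i j) _
        by_cases hil : i ∈ l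
        · simp [hil, hij, ← mul_assoc, hc.eq]
        · simp [hil, hij]
  have := key _ (List.nodup_finRange n)
  simpa [multiPow] using this

theorem idx_induction {P : (Fin n →₀ ℕ) → Prop} (h0 : P 0)
    (h1 : ∀ s i, P s → P (s + Finsupp.single i 1)) (s : Fin n →₀ ℕ) : P s := by
  obtain ⟨k, hk⟩ : ∃ k, s.degree = k := ⟨_, rfl⟩
  induction k generalizing s with
  | zero =>
    rw [Finsupp.degree_eq_zero_iff] at hk
    exact hk ▸ h0
  | succ k ih =>
    have hs : s ≠ 0 := by
      rintro rfl
      simp at hk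
    obtain ⟨i, hi⟩ := Finsupp.ne_iff.1 hs
    have hle : Finsupp.single i 1 ≤ s := by
      rw [Finsupp.single_le_iff]
      exact Nat.one_le_iff_ne_zero.2 hi
    have he : s - Finsupp.single i 1 + Finsupp.single i 1 = s := tsub_add_cancel_of_le hle
    rw [← he]
    refine h1 _ _ (ih _ ?_)
    have := congrArg Finsupp.degree he
    rw [map_add, Finsupp.degree_single, hk] at this
    omega

theorem comm_mem_span_cre (i : Fin n) (s : Fin n →₀ ℕ) :
    ann i * multiPow cre s - multiPow cre s * ann i
      ∈ Submodule.span ℂ (Set.range (multiPow (n := n) cre)) := by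
  have hC : ∀ (j : Fin n), ∀ c ∈ Submodule.span ℂ (Set.range (multiPow (n := n) cre)),
      cre j * c ∈ Submodule.span ℂ (Set.range (multiPow (n := n) cre)) := by
    intro j c hc
    induction hc using Submodule.span_induction with
    | mem x hx =>
      obtain ⟨u, rfl⟩ := hx
      rw [← multiPow_succ cre cre_mul_cre]
      exact Submodule.subset_span ⟨_, rfl⟩
    | zero => simp
    | add x y _ _ hx hy => rw [mul_add]; exact add_mem hx hy
    | smul a x _ hx => rw [mul_smul_comm]; exact Submodule.smul_mem _ _ hx
  induction s using idx_induction with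
  | h0 => simp [multiPow_zero]
  | h1 s j ih =>
    rw [multiPow_succ cre cre_mul_cre]
    have e : ann i * (cre j * multiPow cre s) - cre j * multiPow cre s * ann i
        = cre j * (ann i * multiPow cre s - multiPow cre s * ann i)
          + (if i = j then 1 else 0) * multiPow cre s := by
      rw [← mul_assoc, ann_mul_cre, add_mul, mul_sub]
      noncomm_ring
    rw [e]
    refine add_mem (hC _ _ ih) ?_
    split_ifs
    · rw [one_mul]; exact Submodule.subset_span ⟨_, rfl⟩
    · rw [zero_mul]; exact zero_mem _

/-- Every element has a normal form. -/
theorem span_normalMonomial (n : ℕ) :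
    ⊤ ≤ Submodule.span ℂ (Set.range (normalMonomial (n := n))) := by
  set M := Submodule.span ℂ (Set.range (normalMonomial (n := n))) with hM
  have hCD : ∀ c ∈ Submodule.span ℂ (Set.range (multiPow (n := n) cre)), ∀ t : Fin n →₀ ℕ,
      c * multiPow ann t ∈ M := by
    intro c hc t
    induction hc using Submodule.span_induction with
    | mem x hx =>
      obtain ⟨u, rfl⟩ := hx
      exact Submodule.subset_span ⟨(u, t), rfl⟩
    | zero => simp
    | add x y _ _ hx hy => rw [add_mul]; exact add_mem hx hy
    | smul a x _ hx => rw [smul_mul_assoc]; exact Submodule.smul_mem _ _ hx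
  have hgen : ∀ g : Weyl n, (∀ m, g * normalMonomial m ∈ M) → ∀ x ∈ M, g * x ∈ M := by
    intro g hg x hx
    induction hx using Submodule.span_induction with
    | mem x hx =>
      obtain ⟨u, rfl⟩ := hx
      exact hg u
    | zero => simp
    | add x y _ _ hx hy => rw [mul_add]; exact add_mem hx hy
    | smul a x _ hx => rw [mul_smul_comm]; exact Submodule.smul_mem _ _ hx
  have hall : ∀ w x : Weyl n, x ∈ M → w * x ∈ M := by
    intro w
    induction w using Weyl.induction with
    | hC c => intro x hx; rw [← Algebra.smul_def]; exact Submodule.smul_mem _ _ hx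
    | hann i =>
      refine hgen _ fun m => ?_
      have e : ann i * normalMonomial m
          = multiPow cre m.1 * multiPow ann (m.2 + Finsupp.single i 1)
            + (ann i * multiPow cre m.1 - multiPow cre m.1 * ann i) * multiPow ann m.2 := by
        rw [multiPow_succ ann ann_mul_ann, normalMonomial]
        noncomm_ring
      rw [e]
      exact add_mem (Submodule.subset_span ⟨(m.1, m.2 + Finsupp.single i 1), rfl⟩)
        (hCD _ (comm_mem_span_cre i m.1) _)
    | hcre i =>
      refine hgen _ fun m => ?_
      rw [normalMonomial, ← mul_assoc, ← multiPow_succ cre cre_mul_cre]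
      exact Submodule.subset_span ⟨(m.1 + Finsupp.single i 1, m.2), rfl⟩
    | hmul a b ha hb => intro x hx; rw [mul_assoc]; exact ha _ (hb _ hx)
    | hadd a b ha hb => intro x hx; rw [add_mul]; exact add_mem (ha _ hx) (hb _ hx)
  intro w _
  have h1 : (1 : Weyl n) ∈ M :=
    Submodule.subset_span ⟨(0, 0), by simp [normalMonomial, multiPow_zero]⟩
  simpa using hall w 1 h1

/-- The action on polynomials in which `a_i` is `∂/∂z_i` and `a_i^*` is multiplication by `z_i`. -/
def fock (n : ℕ) : Weyl n →ₐ[ℂ] Module.End ℂ (MvPolynomial (Fin n) ℂ) :=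
  lift (fun l => match l with
      | .ann i => (MvPolynomial.pderiv i).toLinearMap
      | .cre i => LinearMap.mulLeft ℂ (MvPolynomial.X i))
    (fun i j => by
      refine LinearMap.ext fun f => ?_
      change MvPolynomial.pderiv i (MvPolynomial.pderiv j f)
        = MvPolynomial.pderiv j (MvPolynomial.pderiv i f)
      induction f using MvPolynomial.induction_on with
      | C c => simp
      | add f g hf hg => simp [hf, hg]
      | mul_X f l hf =>
        simp only [Derivation.leibniz, map_add, MvPolynomial.pderiv_X, smul_eq_mul, hf,
          Pi.single_apply, apply_ite (MvPolynomial.pderiv i),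
          apply_ite (MvPolynomial.pderiv j), map_zero, Derivation.map_one_eq_zero]
        ring_nf
        simp)
    (fun i j => by
      refine LinearMap.ext fun f => ?_
      simp [mul_left_comm])
    (fun i j => by
      refine LinearMap.ext fun f => ?_
      by_cases h : i = j
      · subst h; simp [add_comm]
      · simp [h, MvPolynomial.pderiv_X_of_ne (Ne.symm h)])

theorem fock_ann (i : Fin n) : fock n (ann i) = (MvPolynomial.pderiv i).toLinearMap :=
  lift_proj _ _ _ _ (Letter.ann i)

theorem fock_cre (i : Fin n) : fock n (cre i) = LinearMap.mulLeft ℂ (MvPolynomial.X i) :=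
  lift_proj _ _ _ _ (Letter.cre i)

theorem fock_multiPow_cre (s : Fin n →₀ ℕ) (f : MvPolynomial (Fin n) ℂ) :
    fock n (multiPow cre s) f = MvPolynomial.monomial s 1 * f := by
  induction s using idx_induction generalizing f with
  | h0 => simp [multiPow_zero]
  | h1 s i ih =>
    rw [multiPow_succ cre cre_mul_cre, map_mul, Module.End.mul_apply, ih, fock_cre]
    simp [← mul_assoc, MvPolynomial.X, MvPolynomial.monomial_mul, add_comm]

theorem fock_multiPow_ann (t u : Fin n →₀ ℕ) (c : ℂ) :
    fock n (multiPow ann t) (MvPolynomial.monomial u c)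
      = MvPolynomial.monomial (u - t) (c * ∏ i, ((u i).descFactorial (t i) : ℂ)) := by
  induction t using idx_induction with
  | h0 => simp [multiPow_zero]
  | h1 t i ih =>
    rw [multiPow_succ ann ann_mul_ann, map_mul, Module.End.mul_apply, ih, fock_ann]
    simp only [Derivation.coeFn_coe, MvPolynomial.pderiv_monomial]
    rw [tsub_tsub, mul_assoc]
    congr 2
    rw [← Finset.mul_prod_erase Finset.univ _ (Finset.mem_univ i),
      ← Finset.mul_prod_erase Finset.univ (fun j => (((u j).descFactorial
        ((t + Finsupp.single i 1 : Fin n →₀ ℕ) j) : ℕ) : ℂ)) (Finset.mem_univ i)]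
    have e : ∀ j ∈ Finset.univ.erase i, (((u j).descFactorial
        ((t + Finsupp.single i 1 : Fin n →₀ ℕ) j) : ℕ) : ℂ) = ((u j).descFactorial (t j) : ℕ) := by
      intro j hj
      rw [Finset.mem_erase] at hj
      simp [Ne.symm hj.1]
    rw [Finset.prod_congr rfl e]
    simp [Nat.descFactorial_succ]
    ring

/-- The normal form is unique. -/
theorem linearIndependent_normalMonomial (n : ℕ) :
    LinearIndependent ℂ (normalMonomial (n := n)) := by
  rw [linearIndependent_iff]
  intro f hf
  by_contra hne
  have hsupp : f.support.Nonempty := Finsupp.support_nonempty_iff.2 hne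
  obtain ⟨m, hm, hmin⟩ := f.support.exists_min_image (fun m => m.2.degree) hsupp
  have h := congrArg (fun w => fock n w (MvPolynomial.monomial m.2 1)) hf
  simp only [Finsupp.linearCombination_apply, Finsupp.sum, map_sum, map_smul, map_zero,
    LinearMap.sum_apply, LinearMap.smul_apply, LinearMap.zero_apply, normalMonomial, map_mul,
    Module.End.mul_apply, fock_multiPow_ann, fock_multiPow_cre, MvPolynomial.monomial_mul] at h
  have h' := congrArg (MvPolynomial.coeff m.1) h
  rw [MvPolynomial.coeff_sum, MvPolynomial.coeff_zero, Finset.sum_eq_single m] at h'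
  · rw [MvPolynomial.coeff_smul, tsub_self, add_zero, MvPolynomial.coeff_monomial, if_pos rfl] at h'
    simp only [one_mul, smul_eq_mul, mul_eq_zero, Finset.prod_eq_zero_iff] at h'
    rcases h' with h' | ⟨i, _, h'⟩
    · exact (Finsupp.mem_support_iff.1 hm) h'
    · rw [Nat.descFactorial_self] at h'
      exact (Nat.factorial_ne_zero _) (by exact_mod_cast h')
  · intro b hb hbm
    by_cases hle : b.2 ≤ m.2
    · have hd := hmin b hb
      have e : m.2 - b.2 + b.2 = m.2 := tsub_add_cancel_of_le hle
      have hz : m.2 - b.2 = 0 := by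
        have := congrArg Finsupp.degree e
        rw [map_add] at this
        rw [← Finsupp.degree_eq_zero_iff]
        omega
      have h2 : b.2 = m.2 := by rw [hz, zero_add] at e; exact e
      have h1 : b.1 ≠ m.1 := fun h1 => hbm (Prod.ext h1 h2)
      rw [MvPolynomial.coeff_smul, hz, add_zero, MvPolynomial.coeff_monomial, if_neg h1, smul_zero]
    · have : ∃ i, m.2 i < b.2 i := by
        by_contra hcon
        push Not at hcon
        exact hle hcon
      obtain ⟨i, hi⟩ := this
      have hz : ∏ i, ((m.2 i).descFactorial (b.2 i) : ℂ) = 0 :=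
        Finset.prod_eq_zero (Finset.mem_univ i) (by simp [Nat.descFactorial_eq_zero_iff_lt, hi])
      rw [hz]
      simp
  · intro h0
    exact absurd hm h0

/-- The basis of `W_n` that consists of the normally ordered monomials. -/
def normalBasis (n : ℕ) : Module.Basis (Idx n) ℂ (Weyl n) :=
  Module.Basis.mk (linearIndependent_normalMonomial n) (span_normalMonomial n)

/-- The coefficient `p_{s,t}` of the normal form `p = ∑ p_{s,t} (a^*)^s a^t`. -/
def coef (p : Weyl n) (m : Idx n) : ℂ := (normalBasis n).repr p m

/-- `deg p = max {‖s‖₁ + ‖t‖₁ : p_{s,t} ≠ 0}`, with `deg 0 = 0`. -/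
def deg (p : Weyl n) : ℕ := ((normalBasis n).repr p).support.sup Idx.len

/-! ### The programs -/

/-- `Σ²_k`: the sums of squares `∑ f_i^* f_i` with `deg f_i ≤ k`. -/
def SOS (n k : ℕ) : Set (Weyl n) :=
  {q | ∃ (r : ℕ) (f : Fin r → Weyl n), (∀ i, deg (f i) ≤ k) ∧ q = ∑ i, star (f i) * f i}

/-- The indices of the normally ordered monomials of degree at most `d`. -/
abbrev IdxLE (n d : ℕ) : Type := {m : Idx n // m.len ≤ d}

instance (n d : ℕ) : Finite (IdxLE n d) := by
  have h := (Finsupp.finite_of_degree_le (σ := Fin n) d).prod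
    (Finsupp.finite_of_degree_le (σ := Fin n) d)
  refine (h.subset ?_).to_subtype
  rintro ⟨s, t⟩ hm
  have hm' : s.degree + t.degree ≤ d := hm
  exact ⟨le_trans (Nat.le_add_right _ _) hm', le_trans (Nat.le_add_left _ _) hm'⟩

instance (n d : ℕ) : Fintype (IdxLE n d) := Fintype.ofFinite _

/-- The feasible values of the program `sup {λ : p - λ ∈ Σ²_k}`. -/
def sosValues (p : Weyl n) (k : ℕ) : Set ℝ :=
  {x | p - algebraMap ℂ (Weyl n) x ∈ SOS n k}

/-- `(λ, Z)` is a feasible point of the program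
`max {λ : p - λ = (w^k)^* Z w^k, Z ≥ 0}`, where `w^k` is the vector of the normally ordered
monomials of degree at most `k`. -/
def IsFeasibleSosSDP (p : Weyl n) (k : ℕ) (x : ℝ) (Z : Matrix (IdxLE n k) (IdxLE n k) ℂ) : Prop :=
  Z.PosSemidef ∧ p - algebraMap ℂ (Weyl n) x
    = ∑ i, ∑ j, Z i j • (star (normalMonomial i.1) * normalMonomial j.1)

/-- The objective values of the feasible points of the semidefinite sum of squares program. -/
def sosSDPValues (p : Weyl n) (k : ℕ) : Set ℝ :=
  {x | ∃ Z, IsFeasibleSosSDP p k x Z}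

/-- The objective values `L(p)` of the program
`min {L(p) : L(1) = 1, L(q q^*) ≥ 0 for all q with deg q ≤ k}` over linear functionals `L`.
(For hermitian `p` with `deg p ≤ 2k` the value `L(p)` at a feasible `L` is automatically real.) -/
def momentValues (p : Weyl n) (k : ℕ) : Set ℝ :=
  {x | ∃ L : Weyl n →ₗ[ℂ] ℂ,
    L 1 = 1 ∧ (∀ q : Weyl n, deg q ≤ k → 0 ≤ L (q * star q)) ∧ L p = (x : ℂ)}

/-- The moment matrix `M_k(y)` of order `k`. -/
def momentMatrix (n k : ℕ) (y : IdxLE n (2 * k) → ℂ) : Matrix (IdxLE n k) (IdxLE n k) ℂ :=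
  Matrix.of fun i j =>
    ∑ m : IdxLE n (2 * k), coef (star (normalMonomial i.1) * normalMonomial j.1) m.1 * y m

/-- The objective values of the program `min {∑ p_{s,t} y_{s,t} : y_{0,0} = 1, M_k(y) ≥ 0}`.
(For hermitian `p` with `deg p ≤ 2k` the objective is automatically real at feasible `y`.) -/
def momentSDPValues (p : Weyl n) (k : ℕ) : Set ℝ :=
  {x | ∃ y : IdxLE n (2 * k) → ℂ,
    y ⟨(0, 0), by simp [Idx.len]⟩ = 1 ∧ (momentMatrix n k y).PosSemidef ∧
      ∑ m : IdxLE n (2 * k), coef p m.1 * y m = (x : ℂ)}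

end WeylOpt

end

open scoped ComplexOrder

noncomputable section

namespace WeylOpt

variable {n : ℕ}

/-! ### The degree filtration -/

/-! Everything takes place in the finite-dimensional space of elements of degree at most `2 * k`,
which contains `p`, the constants and all products `star f * f` with `deg f ≤ k`. The two programs
in each pair have the same values. A sum of squares is the same as `w^* Z w` with `Z` positive
semidefinite (`mem_SOS_iff`), and a moment matrix is the matrix of the form `(q, r) ↦ L (star q *
r)` (`posSemidef_momentMatrix_iff`). Weak duality comes from applying a feasible `L` to `p - x`.

The heart of the matter is that the cone of sums of squares is closed (`isClosed_sosCone`). It is a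
linear image of the closed cone of positive semidefinite matrices, and such an image is closed once
the kernel meets the cone only in the origin (`isClosed_map_of_ker_inter_eq_zero`). This kernel
condition holds because a state exists that is faithful in degree at most `k`, an average of vector
states of the Fock representation on polynomials (`exists_faithful_functional`).

Closedness has two consequences. The supremum over sums of squares is attained. If `p - b` is not a
sum of squares, a hyperplane separates it from the cone and yields a positive functional that is
negative on `p - b`. This functional may vanish at `1`; adding a small multiple of the faithful
state makes it normalizable, and its value at `p` stays below `b` (`exists_mem_momentValues_lt`).
Hence there is no gap. -/

theorem normalBasis_apply (m : Idx n) : normalBasis n m = normalMonomial m := by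
  simp [normalBasis]

theorem coef_normalMonomial (m m' : Idx n) :
    coef (normalMonomial m) m' = if m = m' then 1 else 0 := by
  rw [coef, ← normalBasis_apply, Module.Basis.repr_self, Finsupp.single_apply]

theorem normalMonomial_zero : normalMonomial ((0, 0) : Idx n) = 1 := by
  simp [normalMonomial, multiPow_zero]

/-- The span of the normally ordered monomials of degree at most `d`. -/
def filtration (n d : ℕ) : Submodule ℂ (Weyl n) :=
  Submodule.span ℂ (normalMonomial '' {m : Idx n | m.len ≤ d})

theorem normalMonomial_mem_filtration {m : Idx n} {d : ℕ} (h : m.len ≤ d) :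
    normalMonomial m ∈ filtration n d :=
  Submodule.subset_span ⟨m, h, rfl⟩

theorem filtration_mono {d e : ℕ} (h : d ≤ e) : filtration n d ≤ filtration n e :=
  Submodule.span_mono (Set.image_mono fun _ hm => le_trans hm h)

theorem mem_filtration_iff {q : Weyl n} {d : ℕ} : q ∈ filtration n d ↔ deg q ≤ d := by
  have e : (normalMonomial : Idx n → Weyl n) = normalBasis n :=
    funext fun m => (normalBasis_apply m).symm
  rw [filtration, e, Module.Basis.mem_span_image, deg, Finset.sup_le_iff]
  rfl

theorem coef_eq_zero_of_mem_filtration {q : Weyl n} {d : ℕ} (hq : q ∈ filtration n d) {m : Idx n}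
    (hm : d < m.len) : coef q m = 0 := by
  by_contra h
  rw [mem_filtration_iff, deg, Finset.sup_le_iff] at hq
  exact absurd (hq m (Finsupp.mem_support_iff.2 h)) (by omega)

/-- The coefficients of the normal form in degree at most `d`. -/
def coefLE (n d : ℕ) : Weyl n →ₗ[ℂ] (IdxLE n d → ℂ) :=
  LinearMap.pi fun m => (Finsupp.lapply m.1) ∘ₗ (normalBasis n).repr.toLinearMap

theorem sum_coef_smul_eq {d : ℕ} {q : Weyl n} (hq : q ∈ filtration n d) :
    ∑ m : IdxLE n d, coef q m.1 • normalMonomial m.1 = q := by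
  refine (normalBasis n).ext_elem fun m' => ?_
  change coef _ m' = coef q m'
  have e : coef (∑ m : IdxLE n d, coef q m.1 • normalMonomial m.1) m'
      = ∑ m : IdxLE n d, coef q m.1 * coef (normalMonomial m.1) m' := by
    simp [coef]
  simp only [e, coef_normalMonomial, mul_ite, mul_one, mul_zero]
  by_cases h : m'.len ≤ d
  · rw [Finset.sum_eq_single ⟨m', h⟩]
    · simp
    · intro b _ hb
      rw [if_neg fun h' => hb (Subtype.ext h')]
    · simp
  · rw [coef_eq_zero_of_mem_filtration hq (not_le.1 h)]
    refine Finset.sum_eq_zero fun b _ => ?_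
    rw [if_neg]
    rintro rfl
    exact h b.2

theorem linearMap_eq_sum_coef {M : Type*} [AddCommGroup M] [Module ℂ M] {d : ℕ}
    (L : Weyl n →ₗ[ℂ] M) {q : Weyl n} (hq : q ∈ filtration n d) :
    L q = ∑ m : IdxLE n d, coef q m.1 • L (normalMonomial m.1) := by
  conv_lhs => rw [← sum_coef_smul_eq hq]
  simp

theorem eq_of_coefLE_eq {d : ℕ} {x y : Weyl n} (hx : x ∈ filtration n d) (hy : y ∈ filtration n d)
    (h : coefLE n d x = coefLE n d y) : x = y := by
  rw [← sum_coef_smul_eq hx, ← sum_coef_smul_eq hy]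
  exact Finset.sum_congr rfl fun m _ => congrArg (· • normalMonomial m.1) (congrFun h m)

/-! ### Multiplicativity of the filtration -/

theorem mul_normalMonomial_mem_filtration (l : Weyl n) {d e : ℕ}
    (hl : ∀ m : Idx n, l * normalMonomial m ∈ filtration n (m.len + e)) {x : Weyl n}
    (hx : x ∈ filtration n d) : l * x ∈ filtration n (d + e) := by
  induction hx using Submodule.span_induction with
  | mem x hx =>
    obtain ⟨m, hm, rfl⟩ := hx
    exact filtration_mono (Nat.add_le_add_right hm e) (hl m)
  | zero => simp
  | add x y _ _ hx hy => rw [mul_add]; exact add_mem hx hy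
  | smul a x _ hx => rw [mul_smul_comm]; exact Submodule.smul_mem _ _ hx

theorem cre_mul_mem_filtration (i : Fin n) {d : ℕ} {x : Weyl n} (hx : x ∈ filtration n d) :
    cre i * x ∈ filtration n (d + 1) := by
  refine mul_normalMonomial_mem_filtration _ (fun m => ?_) hx
  rw [normalMonomial, ← mul_assoc, ← multiPow_succ cre cre_mul_cre]
  refine normalMonomial_mem_filtration (m := (m.1 + Finsupp.single i 1, m.2)) ?_
  simp only [Idx.len, map_add, Finsupp.degree_single]
  omega

/-- Moving `a_i` to the right past the creation operators costs, at each commutation, a term in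
which one creator is gone. The induction on the creation exponent shows that such terms never raise
the degree. -/
theorem ann_mul_mem_filtration (i : Fin n) {d : ℕ} {x : Weyl n} (hx : x ∈ filtration n d) :
    ann i * x ∈ filtration n (d + 1) := by
  refine mul_normalMonomial_mem_filtration _ (fun m => ?_) hx
  obtain ⟨s, t⟩ := m
  induction s using idx_induction with
  | h0 =>
    rw [normalMonomial, multiPow_zero, one_mul, ← multiPow_succ ann ann_mul_ann]
    have := normalMonomial_mem_filtration (n := n) (m := (0, t + Finsupp.single i 1)) le_rfl
    simpa [normalMonomial, multiPow_zero, Idx.len] using this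
  | h1 s j ih =>
    have e : ann i * normalMonomial (s + Finsupp.single j 1, t)
        = cre j * (ann i * normalMonomial (s, t))
          + (if i = j then 1 else 0) * normalMonomial (s, t) := by
      simp only [normalMonomial]
      rw [multiPow_succ cre cre_mul_cre, ← mul_assoc, ← mul_assoc, ann_mul_cre]
      noncomm_ring
    have hlen : Idx.len (s + Finsupp.single j 1, t) = Idx.len (s, t) + 1 := by
      simp only [Idx.len, map_add, Finsupp.degree_single]
      omega
    rw [e, hlen]
    refine add_mem (cre_mul_mem_filtration j ih) ?_
    split_ifs
    · rw [one_mul]; exact normalMonomial_mem_filtration (by omega)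
    · rw [zero_mul]; exact zero_mem _

theorem multiPow_mul_mem_filtration {g : Fin n → Weyl n} (hg : ∀ i j, g i * g j = g j * g i)
    (hmem : ∀ i (d : ℕ) (x : Weyl n), x ∈ filtration n d → g i * x ∈ filtration n (d + 1))
    (s : Fin n →₀ ℕ) {d : ℕ} {x : Weyl n} (hx : x ∈ filtration n d) :
    multiPow g s * x ∈ filtration n (s.degree + d) := by
  induction s using idx_induction with
  | h0 => simpa [multiPow_zero] using hx
  | h1 s i ih =>
    rw [multiPow_succ g hg, mul_assoc, map_add, Finsupp.degree_single, add_right_comm]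
    exact hmem i _ _ ih

theorem mul_mem_filtration {d e : ℕ} {x y : Weyl n} (hx : x ∈ filtration n d)
    (hy : y ∈ filtration n e) : x * y ∈ filtration n (d + e) := by
  induction hx using Submodule.span_induction with
  | mem x hx =>
    obtain ⟨m, hm, rfl⟩ := hx
    rw [normalMonomial, mul_assoc]
    have h := multiPow_mul_mem_filtration cre_mul_cre
      (fun i _ _ => cre_mul_mem_filtration i) m.1
      (multiPow_mul_mem_filtration ann_mul_ann (fun i _ _ => ann_mul_mem_filtration i) m.2 hy)
    refine filtration_mono ?_ h
    rw [← add_assoc]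
    exact Nat.add_le_add_right hm e
  | zero => simp
  | add x y _ _ hx hy => rw [add_mul]; exact add_mem hx hy
  | smul a x _ hx => rw [smul_mul_assoc]; exact Submodule.smul_mem _ _ hx

/-! ### Compatibility of the filtration with the involution -/

theorem commute_multiPow {A : Type*} [Monoid A] (x : Fin n → A)
    (hx : ∀ i j, x i * x j = x j * x i) (i : Fin n) (s : Fin n →₀ ℕ) :
    Commute (x i) (multiPow x s) := by
  induction s using idx_induction with
  | h0 => simp [multiPow_zero]
  | h1 s j ih => rw [multiPow_succ x hx]; exact Commute.mul_right (hx i j) ih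

theorem star_multiPow_cre (s : Fin n →₀ ℕ) :
    star (multiPow (n := n) cre s) = multiPow ann s := by
  induction s using idx_induction with
  | h0 => simp [multiPow_zero]
  | h1 s i ih =>
    rw [multiPow_succ cre cre_mul_cre, multiPow_succ ann ann_mul_ann, star_mul, ih, star_cre,
      (commute_multiPow ann ann_mul_ann i s).eq]

theorem star_normalMonomial (m : Idx n) : star (normalMonomial m) = normalMonomial m.swap := by
  rw [normalMonomial, star_mul, star_multiPow_cre, ← star_multiPow_cre, star_star]
  rfl

theorem star_mem_filtration {d : ℕ} {x : Weyl n} (hx : x ∈ filtration n d) :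
    star x ∈ filtration n d := by
  induction hx using Submodule.span_induction with
  | mem x hx =>
    obtain ⟨m, hm, rfl⟩ := hx
    rw [star_normalMonomial]
    refine normalMonomial_mem_filtration ?_
    rw [Idx.len, add_comm]
    exact hm
  | zero => simp
  | add x y _ _ hx hy => rw [star_add]; exact add_mem hx hy
  | smul a x _ hx => rw [star_smul]; exact Submodule.smul_mem _ _ hx

theorem one_mem_filtration (d : ℕ) : (1 : Weyl n) ∈ filtration n d := by
  rw [← normalMonomial_zero]
  exact normalMonomial_mem_filtration (by simp [Idx.len])

theorem algebraMap_mem_filtration (c : ℂ) (d : ℕ) : algebraMap ℂ (Weyl n) c ∈ filtration n d := by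
  rw [Algebra.algebraMap_eq_smul_one]
  exact Submodule.smul_mem _ _ (one_mem_filtration d)

theorem star_mul_mem_filtration {k : ℕ} {x y : Weyl n} (hx : x ∈ filtration n k)
    (hy : y ∈ filtration n k) : star x * y ∈ filtration n (2 * k) := by
  rw [two_mul]
  exact mul_mem_filtration (star_mem_filtration hx) hy

/-! ### The Fock inner product -/

/-- The inner product on polynomials for which the monomials `z^u` are orthogonal with squared norm
`u!`. -/
def fockInner (f g : MvPolynomial (Fin n) ℂ) : ℂ :=
  ∑ᶠ u : Fin n →₀ ℕ, ((∏ i, (u i).factorial : ℕ) : ℂ) * (star (f.coeff u) * g.coeff u)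

theorem fockInner_support_left (f g : MvPolynomial (Fin n) ℂ) :
    (Function.support fun u : Fin n →₀ ℕ =>
      ((∏ i, (u i).factorial : ℕ) : ℂ) * (star (f.coeff u) * g.coeff u)) ⊆ f.support := by
  intro u hu
  rw [Finset.mem_coe, MvPolynomial.mem_support_iff]
  rintro h
  simp [h] at hu

theorem fockInner_support_right (f g : MvPolynomial (Fin n) ℂ) :
    (Function.support fun u : Fin n →₀ ℕ =>
      ((∏ i, (u i).factorial : ℕ) : ℂ) * (star (f.coeff u) * g.coeff u)) ⊆ g.support := by
  intro u hu
  rw [Finset.mem_coe, MvPolynomial.mem_support_iff]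
  rintro h
  simp [h] at hu

theorem fockInner_hasFiniteSupport (f g : MvPolynomial (Fin n) ℂ) :
    (Function.support fun u : Fin n →₀ ℕ =>
      ((∏ i, (u i).factorial : ℕ) : ℂ) * (star (f.coeff u) * g.coeff u)).Finite :=
  f.support.finite_toSet.subset (fockInner_support_left f g)

theorem fockInner_add_left (f f' g : MvPolynomial (Fin n) ℂ) :
    fockInner (f + f') g = fockInner f g + fockInner f' g := by
  rw [fockInner, fockInner, fockInner, ← finsum_add_distrib (fockInner_hasFiniteSupport _ _)
    (fockInner_hasFiniteSupport _ _)]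
  exact finsum_congr fun u => by rw [MvPolynomial.coeff_add, star_add]; ring

theorem fockInner_star (f g : MvPolynomial (Fin n) ℂ) : star (fockInner f g) = fockInner g f := by
  rw [fockInner, fockInner, finsum_eq_sum_of_support_subset _ (fockInner_support_left f g),
    finsum_eq_sum_of_support_subset _ (fockInner_support_right g f), star_sum]
  refine Finset.sum_congr rfl fun u _ => ?_
  simp [mul_comm]

theorem fockInner_add_right (f g g' : MvPolynomial (Fin n) ℂ) :
    fockInner f (g + g') = fockInner f g + fockInner f g' := by
  rw [← fockInner_star, fockInner_add_left, star_add, fockInner_star, fockInner_star]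

theorem fockInner_smul_right (c : ℂ) (f g : MvPolynomial (Fin n) ℂ) :
    fockInner f (c • g) = c * fockInner f g := by
  rw [fockInner, fockInner, ← smul_eq_mul, smul_finsum]
  exact finsum_congr fun u => by rw [MvPolynomial.coeff_smul, smul_eq_mul, smul_eq_mul]; ring

theorem fockInner_smul_left (c : ℂ) (f g : MvPolynomial (Fin n) ℂ) :
    fockInner (c • f) g = star c * fockInner f g := by
  rw [← fockInner_star, fockInner_smul_right, star_mul', fockInner_star]

theorem fockInner_monomial_left (u : Fin n →₀ ℕ) (c : ℂ) (g : MvPolynomial (Fin n) ℂ) :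
    fockInner (MvPolynomial.monomial u c) g
      = ((∏ i, (u i).factorial : ℕ) : ℂ) * (star c * g.coeff u) := by
  rw [fockInner, finsum_eq_single _ u]
  · simp
  · intro v hv
    rw [MvPolynomial.coeff_monomial, if_neg hv.symm]
    simp

/-- The weights `u!` are chosen for this adjointness: raising `u i` by one multiplies the weight by
`u i + 1`, the factor that differentiation produces. -/
theorem fockInner_X_mul_left (i : Fin n) (f g : MvPolynomial (Fin n) ℂ) :
    fockInner (MvPolynomial.X i * f) g = fockInner f (MvPolynomial.pderiv i g) := by
  induction f using MvPolynomial.induction_on' with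
  | add f f' hf hf' => rw [mul_add, fockInner_add_left, fockInner_add_left, hf, hf']
  | monomial u c =>
    rw [MvPolynomial.X, MvPolynomial.monomial_mul, one_mul, fockInner_monomial_left,
      fockInner_monomial_left, MvPolynomial.coeff_pderiv, add_comm]
    rw [← Finset.mul_prod_erase Finset.univ _ (Finset.mem_univ i),
      ← Finset.mul_prod_erase Finset.univ (fun j => (u j).factorial) (Finset.mem_univ i)]
    have e : ∀ j ∈ Finset.univ.erase i,
        ((u + Finsupp.single i 1 : Fin n →₀ ℕ) j).factorial = (u j).factorial := by
      intro j hj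
      rw [Finset.mem_erase] at hj
      simp [Ne.symm hj.1]
    rw [Finset.prod_congr rfl e]
    simp [Nat.factorial_succ]
    ring

/-- The Fock representation is a `*`-representation, since this holds on the generators and passes
to sums and products. It turns values on `star q * q` into squared norms. -/
theorem fockInner_fock_star (q : Weyl n) (f g : MvPolynomial (Fin n) ℂ) :
    fockInner f (fock n (star q) g) = fockInner (fock n q f) g := by
  induction q using Weyl.induction generalizing f g with
  | hC c =>
    rw [← algebraMap_star_comm, AlgHom.commutes, AlgHom.commutes, Module.algebraMap_end_apply,
      Module.algebraMap_end_apply, fockInner_smul_right, fockInner_smul_left]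
  | hann i =>
    rw [star_ann, fock_cre, fock_ann, LinearMap.mulLeft_apply, ← fockInner_star,
      fockInner_X_mul_left, fockInner_star]
    rfl
  | hcre i =>
    rw [star_cre, fock_cre, fock_ann, LinearMap.mulLeft_apply, fockInner_X_mul_left]
    rfl
  | hmul x y hx hy =>
    rw [star_mul, map_mul, map_mul, Module.End.mul_apply, Module.End.mul_apply, hy, hx]
  | hadd x y hx hy =>
    rw [star_add, map_add, map_add, LinearMap.add_apply, LinearMap.add_apply, fockInner_add_right,
      fockInner_add_left, hx, hy]

theorem fockInner_self_term_nonneg (f : MvPolynomial (Fin n) ℂ) (u : Fin n →₀ ℕ) :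
    0 ≤ ((∏ i, (u i).factorial : ℕ) : ℂ) * (star (f.coeff u) * f.coeff u) :=
  mul_nonneg (Nat.cast_nonneg _) (star_mul_self_nonneg _)

theorem fockInner_self_nonneg (f : MvPolynomial (Fin n) ℂ) : 0 ≤ fockInner f f :=
  finsum_nonneg (fockInner_self_term_nonneg f)

theorem eq_zero_of_fockInner_self_eq_zero {f : MvPolynomial (Fin n) ℂ} (h : fockInner f f = 0) :
    f = 0 := by
  rw [fockInner, finsum_eq_sum_of_support_subset _ (fockInner_support_left f f),
    Finset.sum_eq_zero_iff_of_nonneg fun u _ => fockInner_self_term_nonneg f u] at h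
  by_contra hf
  obtain ⟨u, hu⟩ := MvPolynomial.support_nonempty.2 hf
  have hpos : ((∏ i, (u i).factorial : ℕ) : ℂ) ≠ 0 :=
    Nat.cast_ne_zero.2 (Finset.prod_ne_zero_iff.2 fun i _ => Nat.factorial_ne_zero _)
  have := h u hu
  rw [MvPolynomial.mem_support_iff] at hu
  simp only [mul_eq_zero, hpos, star_eq_zero, or_self, false_or] at this
  exact hu this

/-- An element of degree at most `k` that annihilates the monomials of degree at most `k` is
zero. -/
theorem eq_zero_of_fock_monomial_eq_zero {k : ℕ} {q : Weyl n} (hq : q ∈ filtration n k)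
    (h0 : ∀ u : Fin n →₀ ℕ, u.degree ≤ k → fock n q (MvPolynomial.monomial u 1) = 0) : q = 0 := by
  by_contra hne
  set f := (normalBasis n).repr q with hf
  have hq' : q = Finsupp.linearCombination ℂ normalMonomial f := by
    conv_lhs => rw [← (normalBasis n).linearCombination_repr q]
    congr 2
    exact funext normalBasis_apply
  have hsupp : f.support.Nonempty := by
    rw [Finsupp.support_nonempty_iff, hf]
    exact fun h => hne ((normalBasis n).repr.map_eq_zero_iff.1 h)
  -- Choose a term with the fewest annihilators and apply `q` to `z ^ m.2`. A term `b` survives only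
  -- if `b.2 ≤ m.2`, and minimality then forces `b.2 = m.2`. The coefficient at `z ^ m.1` therefore
  -- isolates the term `m`. Since `m.2` has degree at most `k`, the test monomial is among the
  -- allowed ones.
  obtain ⟨m, hm, hmin⟩ := f.support.exists_min_image (fun m => m.2.degree) hsupp
  have hmk : m.2.degree ≤ k := by
    rw [mem_filtration_iff, deg, Finset.sup_le_iff] at hq
    exact le_trans (Nat.le_add_left _ _) (hq m hm)
  have h := h0 m.2 hmk
  rw [hq'] at h
  simp only [Finsupp.linearCombination_apply, Finsupp.sum, map_sum, map_smul,
    LinearMap.sum_apply, LinearMap.smul_apply, normalMonomial, map_mul,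
    Module.End.mul_apply, fock_multiPow_ann, fock_multiPow_cre, MvPolynomial.monomial_mul] at h
  have h' := congrArg (MvPolynomial.coeff m.1) h
  rw [MvPolynomial.coeff_sum, MvPolynomial.coeff_zero, Finset.sum_eq_single_of_mem m hm] at h'
  · rw [MvPolynomial.coeff_smul, tsub_self, add_zero, MvPolynomial.coeff_monomial, if_pos rfl] at h'
    simp only [one_mul, smul_eq_mul, mul_eq_zero, Finset.prod_eq_zero_iff] at h'
    rcases h' with h' | ⟨i, _, h'⟩
    · exact (Finsupp.mem_support_iff.1 hm) h'
    · rw [Nat.descFactorial_self] at h'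
      exact (Nat.factorial_ne_zero _) (by exact_mod_cast h')
  · intro b hb hbm
    by_cases hle : b.2 ≤ m.2
    · have hd := hmin b hb
      have e : m.2 - b.2 + b.2 = m.2 := tsub_add_cancel_of_le hle
      have hz : m.2 - b.2 = 0 := by
        have := congrArg Finsupp.degree e
        rw [map_add] at this
        rw [← Finsupp.degree_eq_zero_iff]
        omega
      have h2 : b.2 = m.2 := by rw [hz, zero_add] at e; exact e
      have h1 : b.1 ≠ m.1 := fun h1 => hbm (Prod.ext h1 h2)
      rw [MvPolynomial.coeff_smul, hz, add_zero, MvPolynomial.coeff_monomial, if_neg h1, smul_zero]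
    · obtain ⟨i, hi⟩ : ∃ i, m.2 i < b.2 i := by
        by_contra hcon
        push Not at hcon
        exact hle hcon
      have hz : ∏ i, ((m.2 i).descFactorial (b.2 i) : ℂ) = 0 :=
        Finset.prod_eq_zero (Finset.mem_univ i) (by simp [Nat.descFactorial_eq_zero_iff_lt, hi])
      rw [hz]
      simp

/-- A state that is faithful on the elements of degree at most `k`. -/
theorem exists_faithful_functional (n k : ℕ) : ∃ L : Weyl n →ₗ[ℂ] ℂ, L 1 = 1 ∧
    (∀ q, 0 ≤ L (star q * q)) ∧ ∀ q ∈ filtration n k, L (star q * q) = 0 → q = 0 := by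
  have hfin : {u : Fin n →₀ ℕ | u.degree ≤ k}.Finite := Finsupp.finite_of_degree_le k
  set S := hfin.toFinset with hS
  have hS0 : (0 : Fin n →₀ ℕ) ∈ S := by simp [hS]
  -- The vector state at the normalized `z ^ u`: the coefficient of `z ^ u` in `q z ^ u` is `⟨z ^ u,
  -- q z ^ u⟩ / u!`.
  let φ : (Fin n →₀ ℕ) → Weyl n →ₗ[ℂ] ℂ := fun u =>
    (MvPolynomial.lcoeff ℂ u) ∘ₗ (LinearMap.applyₗ (MvPolynomial.monomial u (1 : ℂ)))
      ∘ₗ (fock n).toLinearMap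
  have hφ : ∀ u q, φ u q = (fock n q (MvPolynomial.monomial u 1)).coeff u := fun u q => rfl
  have hfac : ∀ u : Fin n →₀ ℕ, (0 : ℂ) < ((∏ i, (u i).factorial : ℕ) : ℂ) := fun u =>
    Nat.cast_pos.2 (Finset.prod_pos fun i _ => Nat.factorial_pos _)
  have hkey : ∀ u q, ((∏ i, (u i).factorial : ℕ) : ℂ) * φ u (star q * q)
      = fockInner (fock n q (MvPolynomial.monomial u 1)) (fock n q (MvPolynomial.monomial u 1)) := by
    intro u q
    rw [← fockInner_fock_star, fockInner_monomial_left, hφ, map_mul, Module.End.mul_apply]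
    simp
  have hnn : ∀ u q, 0 ≤ φ u (star q * q) := by
    intro u q
    rw [(eq_inv_mul_iff_mul_eq₀ (hfac u).ne').2 (hkey u q)]
    exact mul_nonneg (inv_nonneg.2 (hfac u).le) (fockInner_self_nonneg _)
  have hc : (0 : ℂ) < (S.card : ℂ) := Nat.cast_pos.2 (Finset.card_pos.2 ⟨0, hS0⟩)
  -- The average over all `u` of degree at most `k`. If it vanishes on `star q * q`, then so does
  -- each vector state, and `q` annihilates all these monomials.
  refine ⟨((S.card : ℂ)⁻¹) • ∑ u ∈ S, φ u, ?_, ?_, ?_⟩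
  · have : ∀ u, φ u 1 = 1 := fun u => by rw [hφ]; simp
    simp [this, hc.ne']
  · intro q
    rw [LinearMap.smul_apply, LinearMap.sum_apply, smul_eq_mul]
    exact mul_nonneg (inv_nonneg.2 hc.le) (Finset.sum_nonneg fun u _ => hnn u q)
  · intro q hq h
    rw [LinearMap.smul_apply, LinearMap.sum_apply, smul_eq_mul, mul_eq_zero,
      or_iff_right (inv_ne_zero hc.ne'),
      Finset.sum_eq_zero_iff_of_nonneg fun u _ => hnn u q] at h
    refine eq_zero_of_fock_monomial_eq_zero hq fun u hu => ?_
    apply eq_zero_of_fockInner_self_eq_zero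
    rw [← hkey, h u (by simpa [hS] using hu), mul_zero]

/-! ### Closed cones -/

/-- The image of a closed cone under a linear map is closed if the kernel meets the cone only in the
origin. -/
theorem isClosed_map_of_ker_inter_eq_zero {E F : Type*} [NormedAddCommGroup F] [NormedSpace ℝ F]
    [FiniteDimensional ℝ F] [NormedAddCommGroup E] [NormedSpace ℝ E] (f : F →ₗ[ℝ] E)
    (C : PointedCone ℝ F) (hC : IsClosed (C : Set F)) (hker : ∀ x ∈ C, f x = 0 → x = 0) :
    IsClosed (C.map f : Set E) := by
  have : ProperSpace F := FiniteDimensional.proper ℝ F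
  have hf : Continuous f := f.continuous_of_finiteDimensional
  -- The constant is the minimum of `‖f x‖` on the compact set of unit vectors of the cone, which is
  -- positive by `hker`. If the cone has no unit vector, any constant will do.
  obtain ⟨c, hc, hbound⟩ : ∃ c : ℝ, 0 < c ∧ ∀ x ∈ C, c * ‖x‖ ≤ ‖f x‖ := by
    have hcomp : IsCompact ((C : Set F) ∩ Metric.sphere 0 1) :=
      (isCompact_sphere 0 1).inter_left hC
    have hscale : ∀ c : ℝ, (∀ x ∈ (C : Set F) ∩ Metric.sphere 0 1, c ≤ ‖f x‖) →
        ∀ x ∈ C, c * ‖x‖ ≤ ‖f x‖ := by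
      intro c h x hx
      rcases eq_or_ne x 0 with rfl | hx0
      · simp
      have hpos : 0 < ‖x‖ := norm_pos_iff.2 hx0
      have hmem : ‖x‖⁻¹ • x ∈ C := PointedCone.smul_mem C (inv_nonneg.2 hpos.le) hx
      have := h _ ⟨hmem, by simp [norm_smul, hpos.ne']⟩
      rw [map_smul, norm_smul, norm_inv, norm_norm, ← div_eq_inv_mul, le_div_iff₀ hpos] at this
      exact this
    rcases ((C : Set F) ∩ Metric.sphere 0 1).eq_empty_or_nonempty with he | hne
    · exact ⟨1, one_pos, hscale 1 (by simp [he])⟩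
    · obtain ⟨x₀, hx₀, hmin⟩ := hcomp.exists_isMinOn hne hf.norm.continuousOn
      refine ⟨‖f x₀‖, norm_pos_iff.2 fun h => ?_, hscale _ fun x hx => hmin hx⟩
      have h1 := hx₀.2
      rw [hker x₀ hx₀.1 h] at h1
      simp at h1
  refine IsSeqClosed.isClosed fun y y₀ hy hlim => ?_
  choose x hxC hxy using hy
  -- The lower bound keeps preimages of a convergent sequence bounded, so a subsequence of them
  -- converges inside the closed cone.
  obtain ⟨R, hR⟩ := (Metric.isBounded_range_of_tendsto y hlim).exists_norm_le
  have hx : ∀ m, x m ∈ Metric.closedBall (0 : F) (R / c) := by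
    intro m
    rw [mem_closedBall_zero_iff, le_div_iff₀ hc, mul_comm]
    refine (hbound _ (hxC m)).trans ?_
    have h : f (x m) = y m := hxy m
    rw [h]
    exact hR _ ⟨m, rfl⟩
  obtain ⟨a, -, φ, hφ, ha⟩ := tendsto_subseq_of_bounded Metric.isBounded_closedBall hx
  refine ⟨a, hC.mem_of_tendsto ha (Filter.Eventually.of_forall fun m => hxC _), ?_⟩
  refine tendsto_nhds_unique ((hf.tendsto a).comp ha) ?_
  have e : f ∘ x ∘ φ = y ∘ φ := funext fun m => hxy (φ m)
  rw [e]
  exact hlim.comp hφ.tendsto_atTop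

/-- The cone of positive semidefinite matrices. -/
def posSemidefCone (ι : Type*) [Fintype ι] : PointedCone ℝ (ι → ι → ℂ) where
  carrier := {Z | (Matrix.of Z).PosSemidef}
  add_mem' := fun {_ _} ha hb => Matrix.PosSemidef.add ha hb
  zero_mem' := Matrix.PosSemidef.zero
  smul_mem' := fun c _ hx => Matrix.PosSemidef.smul hx c.2

theorem isClosed_posSemidefCone (ι : Type*) [Fintype ι] :
    IsClosed (posSemidefCone ι : Set (ι → ι → ℂ)) := by
  have e : (posSemidefCone ι : Set (ι → ι → ℂ))
      = {Z | (Matrix.of Z).IsHermitian} ∩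
        ⋂ x : ι → ℂ, {Z | 0 ≤ star x ⬝ᵥ (Matrix.of Z).mulVec x} := by
    ext Z
    simp only [Set.mem_inter_iff, Set.mem_iInter, Set.mem_ofPred_eq]
    exact Matrix.posSemidef_iff_dotProduct_mulVec
  rw [e]
  refine IsClosed.inter ?_ (isClosed_iInter fun x => ?_)
  · have h : {Z : ι → ι → ℂ | (Matrix.of Z).IsHermitian}
        = ⋂ i, ⋂ j, {Z : ι → ι → ℂ | star (Z j i) = Z i j} := by
      ext Z
      simp [Matrix.IsHermitian.ext_iff]
    rw [h]
    refine isClosed_iInter fun i => isClosed_iInter fun j => isClosed_eq ?_ ?_ <;> fun_prop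
  · refine isClosed_le continuous_const ?_
    simp only [dotProduct, Matrix.mulVec, Matrix.of_apply]
    fun_prop

/-! ### Gram matrices -/

open scoped MatrixOrder in
theorem exists_eq_conjTranspose_mul_self {ι : Type*} [Fintype ι] {Z : Matrix ι ι ℂ}
    (hZ : Z.PosSemidef) : ∃ B : Matrix ι ι ℂ, Z = B.conjTranspose * B := by
  classical
  exact CStarAlgebra.nonneg_iff_eq_star_mul_self.1 hZ.nonneg

/-- The linear combination of normally ordered monomials with coefficients `b`. -/
def comb {k : ℕ} (b : IdxLE n k → ℂ) : Weyl n := ∑ i, b i • normalMonomial i.1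

theorem comb_mem_filtration {k : ℕ} (b : IdxLE n k → ℂ) : comb b ∈ filtration n k :=
  Submodule.sum_mem _ fun i _ => Submodule.smul_mem _ _ (normalMonomial_mem_filtration i.2)

theorem exists_eq_comb {k : ℕ} {q : Weyl n} (hq : q ∈ filtration n k) :
    ∃ b : IdxLE n k → ℂ, q = comb b :=
  ⟨coefLE n k q, (sum_coef_smul_eq hq).symm⟩

theorem comb_eq_zero {k : ℕ} {b : IdxLE n k → ℂ} (h : comb b = 0) : b = 0 := by
  have hli := (linearIndependent_normalMonomial n).comp (Subtype.val : IdxLE n k → Idx n)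
    Subtype.val_injective
  exact funext (Fintype.linearIndependent_iff.1 hli b h)

theorem star_comb_mul_comb {k : ℕ} (b b' : IdxLE n k → ℂ) :
    star (comb b) * comb b'
      = ∑ i, ∑ j, (star (b i) * b' j) • (star (normalMonomial i.1) * normalMonomial j.1) := by
  rw [comb, comb, star_sum, Finset.sum_mul]
  refine Finset.sum_congr rfl fun i _ => ?_
  rw [Finset.mul_sum]
  refine Finset.sum_congr rfl fun j _ => ?_
  rw [star_smul, smul_mul_smul_comm]

/-- The linear map that sends a Gram matrix `Z` to `w^* Z w`. -/
def gram (n k : ℕ) : (IdxLE n k → IdxLE n k → ℂ) →ₗ[ℂ] Weyl n where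
  toFun Z := ∑ i, ∑ j, Z i j • (star (normalMonomial i.1) * normalMonomial j.1)
  map_add' Z Z' := by simp [add_smul, Finset.sum_add_distrib]
  map_smul' c Z := by simp [mul_smul, Finset.smul_sum]

theorem gram_mem_filtration {k : ℕ} (Z : IdxLE n k → IdxLE n k → ℂ) :
    gram n k Z ∈ filtration n (2 * k) :=
  Submodule.sum_mem _ fun i _ => Submodule.sum_mem _ fun j _ => Submodule.smul_mem _ _
    (star_mul_mem_filtration (normalMonomial_mem_filtration i.2)
      (normalMonomial_mem_filtration j.2))

/-- The rows of `B` are the coefficient vectors of the elements that get squared. -/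
theorem gram_conjTranspose_mul_self {k : ℕ} {ι : Type*} [Fintype ι]
    (B : Matrix ι (IdxLE n k) ℂ) :
    gram n k (B.conjTranspose * B) = ∑ l, star (comb (B l)) * comb (B l) := by
  simp only [star_comb_mul_comb]
  rw [Finset.sum_comm]
  refine Finset.sum_congr rfl fun i _ => ?_
  rw [Finset.sum_comm]
  refine Finset.sum_congr rfl fun j _ => ?_
  rw [← Finset.sum_smul]
  rfl

theorem exists_gram_eq_of_posSemidef {k : ℕ} {Z : Matrix (IdxLE n k) (IdxLE n k) ℂ}
    (hZ : Z.PosSemidef) : ∃ B : Matrix (IdxLE n k) (IdxLE n k) ℂ,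
      Z = B.conjTranspose * B ∧ gram n k Z = ∑ l, star (comb (B l)) * comb (B l) := by
  obtain ⟨B, rfl⟩ := exists_eq_conjTranspose_mul_self hZ
  exact ⟨B, rfl, gram_conjTranspose_mul_self B⟩

/-- The Gram matrix method: stacking the coefficient vectors of the `f i` as rows of `B` gives `Z =
B^* B`. Conversely, every positive semidefinite `Z` factors in this way, so as many squares as there
are monomials suffice. -/
theorem mem_SOS_iff {k : ℕ} {q : Weyl n} :
    q ∈ SOS n k ↔ ∃ Z : Matrix (IdxLE n k) (IdxLE n k) ℂ, Z.PosSemidef ∧ q = gram n k Z := by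
  constructor
  · rintro ⟨r, f, hf, rfl⟩
    choose b hb using fun i => exists_eq_comb (mem_filtration_iff.2 (hf i))
    refine ⟨(Matrix.of b).conjTranspose * Matrix.of b,
      Matrix.posSemidef_conjTranspose_mul_self _, ?_⟩
    rw [gram_conjTranspose_mul_self]
    exact Finset.sum_congr rfl fun i _ => by rw [hb i]; rfl
  · rintro ⟨Z, hZ, rfl⟩
    obtain ⟨B, -, h⟩ := exists_gram_eq_of_posSemidef hZ
    let e := Fintype.equivFin (IdxLE n k)
    refine ⟨_, fun i => comb (B (e.symm i)),
      fun i => mem_filtration_iff.1 (comb_mem_filtration _), ?_⟩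
    rw [h]
    exact (Equiv.sum_comp e.symm fun l => star (comb (B l)) * comb (B l)).symm

theorem sosValues_eq_sosSDPValues (p : Weyl n) (k : ℕ) : sosValues p k = sosSDPValues p k :=
  Set.ext fun _ => mem_SOS_iff

theorem nonneg_gram {k : ℕ} {L : Weyl n →ₗ[ℂ] ℂ}
    (hL : ∀ q ∈ filtration n k, 0 ≤ L (star q * q))
    {Z : Matrix (IdxLE n k) (IdxLE n k) ℂ} (hZ : Z.PosSemidef) : 0 ≤ L (gram n k Z) := by
  obtain ⟨B, -, h⟩ := exists_gram_eq_of_posSemidef hZ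
  rw [h, map_sum]
  exact Finset.sum_nonneg fun l _ => hL _ (comb_mem_filtration _)

/-- The coefficient map of `w^* Z w`, over the reals. -/
def gramCoef (n k : ℕ) : (IdxLE n k → IdxLE n k → ℂ) →ₗ[ℝ] (IdxLE n (2 * k) → ℂ) :=
  ((coefLE n (2 * k)) ∘ₗ gram n k).restrictScalars ℝ

/-- The cone of sums of squares, in coefficients, is closed. -/
theorem isClosed_sosCone (n k : ℕ) :
    IsClosed ((posSemidefCone (IdxLE n k)).map (gramCoef n k) : Set (IdxLE n (2 * k) → ℂ)) := by
  refine isClosed_map_of_ker_inter_eq_zero _ _ (isClosed_posSemidefCone _) fun Z hZ h0 => ?_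
  obtain ⟨L, -, hnn, hfaith⟩ := exists_faithful_functional n k
  have hg : gram n k Z = 0 :=
    eq_of_coefLE_eq (gram_mem_filtration Z) (zero_mem _) (h0.trans (map_zero _).symm)
  obtain ⟨B, hZB, hB⟩ := exists_gram_eq_of_posSemidef (Z := Z) hZ
  -- The faithful functional takes nonnegative values on the squares, and these values sum to zero.
  -- Every square thus has value zero, so every row of `B` gives the zero element and `B = 0`.
  have hs := congrArg L (hB.symm.trans hg)
  rw [map_sum, map_zero, Finset.sum_eq_zero_iff_of_nonneg fun l _ => hnn _] at hs
  have hB0 : B = 0 := funext fun l =>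
    comb_eq_zero (hfaith _ (comb_mem_filtration _) (hs l (Finset.mem_univ l)))
  rw [hZB, hB0]
  simp
  rfl

/-! ### The moment programs -/

/-- The involution preserves the filtration, so `q` may be replaced by `star q`. This reconciles the
order `q * star q` in the moment program with `star q * q` in the sums of squares. -/
theorem mem_momentValues_iff {p : Weyl n} {k : ℕ} {x : ℝ} :
    x ∈ momentValues p k ↔ ∃ L : Weyl n →ₗ[ℂ] ℂ,
      L 1 = 1 ∧ (∀ q ∈ filtration n k, 0 ≤ L (star q * q)) ∧ L p = (x : ℂ) := by
  refine exists_congr fun L => and_congr_right fun _ => and_congr_left fun _ => ?_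
  constructor
  · intro h q hq
    simpa using h (star q) (mem_filtration_iff.1 (star_mem_filtration hq))
  · intro h q hq
    simpa using h (star q) (star_mem_filtration (mem_filtration_iff.2 hq))

/-- The linear functional with prescribed moments. -/
def momentFunctional {d : ℕ} (y : IdxLE n d → ℂ) : Weyl n →ₗ[ℂ] ℂ :=
  Fintype.linearCombination ℂ y ∘ₗ coefLE n d

theorem momentFunctional_apply {d : ℕ} (y : IdxLE n d → ℂ) (q : Weyl n) :
    momentFunctional y q = ∑ m : IdxLE n d, coef q m.1 * y m := rfl

theorem momentFunctional_restrict {d : ℕ} (L : Weyl n →ₗ[ℂ] ℂ) {q : Weyl n}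
    (hq : q ∈ filtration n d) :
    momentFunctional (fun m : IdxLE n d => L (normalMonomial m.1)) q = L q := by
  rw [momentFunctional_apply, linearMap_eq_sum_coef L hq]
  rfl

theorem momentFunctional_normalMonomial {d : ℕ} (y : IdxLE n d → ℂ) (m : IdxLE n d) :
    momentFunctional y (normalMonomial m.1) = y m := by
  rw [momentFunctional_apply, Finset.sum_eq_single m]
  · simp [coef_normalMonomial]
  · intro b _ hb
    rw [coef_normalMonomial, if_neg fun h => hb (Subtype.ext h.symm), zero_mul]
  · simp

theorem momentMatrix_apply {k : ℕ} (y : IdxLE n (2 * k) → ℂ) (i j : IdxLE n k) :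
    momentMatrix n k y i j
      = momentFunctional y (star (normalMonomial i.1) * normalMonomial j.1) := rfl

theorem dotProduct_momentMatrix_mulVec {k : ℕ} (y : IdxLE n (2 * k) → ℂ) (b : IdxLE n k → ℂ) :
    star b ⬝ᵥ (momentMatrix n k y).mulVec b = momentFunctional y (star (comb b) * comb b) := by
  simp only [star_comb_mul_comb, map_sum, map_smul, dotProduct, Matrix.mulVec, momentMatrix_apply,
    smul_eq_mul, Finset.mul_sum, Pi.star_apply]
  exact Finset.sum_congr rfl fun i _ => Finset.sum_congr rfl fun j _ => by ring

/-- In the order on `ℂ` a nonnegative number is real, and a complex quadratic form with only real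
values comes from a hermitian matrix, by polarization. -/
theorem isHermitian_of_dotProduct_mulVec_nonneg {ι : Type*} [Fintype ι] {A : Matrix ι ι ℂ}
    (h : ∀ x, 0 ≤ star x ⬝ᵥ A.mulVec x) : A.IsHermitian := by
  classical
  rw [← Matrix.isSymmetric_toEuclideanLin_iff, LinearMap.isSymmetric_iff_inner_map_self_real]
  intro v
  have hv : inner ℂ v (A.toEuclideanLin v) = star v.ofLp ⬝ᵥ A.mulVec v.ofLp := by
    rw [EuclideanSpace.inner_eq_star_dotProduct, dotProduct_comm]
    rfl
  rw [inner_conj_symm, ← inner_conj_symm (A.toEuclideanLin v) v, hv]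
  exact (IsSelfAdjoint.of_nonneg (h v)).star_eq.symm

theorem posSemidef_momentMatrix_iff {k : ℕ} (y : IdxLE n (2 * k) → ℂ) :
    (momentMatrix n k y).PosSemidef ↔
      ∀ q ∈ filtration n k, 0 ≤ momentFunctional y (star q * q) := by
  have h : (∀ q ∈ filtration n k, 0 ≤ momentFunctional y (star q * q)) ↔
      ∀ b : IdxLE n k → ℂ, 0 ≤ star b ⬝ᵥ (momentMatrix n k y).mulVec b := by
    simp only [dotProduct_momentMatrix_mulVec]
    refine ⟨fun h b => h _ (comb_mem_filtration b), fun h q hq => ?_⟩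
    obtain ⟨b, rfl⟩ := exists_eq_comb hq
    exact h b
  rw [h, Matrix.posSemidef_iff_dotProduct_mulVec]
  exact and_iff_right_of_imp isHermitian_of_dotProduct_mulVec_nonneg

theorem momentValues_eq_momentSDPValues {p : Weyl n} {k : ℕ} (hk : deg p ≤ 2 * k) :
    momentValues p k = momentSDPValues p k := by
  ext x
  rw [mem_momentValues_iff]
  constructor
  · rintro ⟨L, h1, hL, hp⟩
    refine ⟨fun m => L (normalMonomial m.1), ?_, ?_, ?_⟩
    · exact (congrArg L normalMonomial_zero).trans h1
    · rw [posSemidef_momentMatrix_iff]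
      intro q hq
      rw [momentFunctional_restrict L (star_mul_mem_filtration hq hq)]
      exact hL q hq
    · rw [← momentFunctional_apply, momentFunctional_restrict L (mem_filtration_iff.2 hk), hp]
  · rintro ⟨y, h1, hy, hp⟩
    -- This functional is zero on normally ordered monomials of degree above `2 * k`. That choice is
    -- harmless, as only `1`, `p` and products `star q * q` of degree at most `2 * k` are tested.
    refine ⟨momentFunctional y, ?_, (posSemidef_momentMatrix_iff y).1 hy, hp⟩
    rw [← h1, ← momentFunctional_normalMonomial y, normalMonomial_zero]

/-! ### Duality -/

theorem exists_ofReal_eq_of_nonneg {z : ℂ} (hz : 0 ≤ z) : ∃ a : ℝ, 0 ≤ a ∧ (a : ℂ) = z :=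
  ⟨z.re, (Complex.nonneg_iff.1 hz).1, Complex.ext rfl (Complex.nonneg_iff.1 hz).2⟩

theorem mem_sosCone_iff {k : ℕ} {q : Weyl n} (hq : q ∈ filtration n (2 * k)) :
    coefLE n (2 * k) q ∈ (posSemidefCone (IdxLE n k)).map (gramCoef n k) ↔ q ∈ SOS n k := by
  rw [mem_SOS_iff]
  constructor
  · rintro ⟨Z, hZ, h⟩
    exact ⟨Z, hZ, (eq_of_coefLE_eq (gram_mem_filtration Z) hq h).symm⟩
  · rintro ⟨Z, hZ, rfl⟩
    exact ⟨Z, hZ, rfl⟩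

/-- Weak duality: `L` is nonnegative on the sum of squares `p - x`, and `L 1 = 1`. -/
theorem le_of_mem_sosValues_of_mem_momentValues {p : Weyl n} {k : ℕ} {x y : ℝ}
    (hx : x ∈ sosValues p k) (hy : y ∈ momentValues p k) : x ≤ y := by
  obtain ⟨L, h1, hL, hp⟩ := mem_momentValues_iff.1 hy
  obtain ⟨Z, hZ, h⟩ := mem_SOS_iff.1 hx
  have h0 := nonneg_gram hL hZ
  rw [← h, map_sub, hp, Algebra.algebraMap_eq_smul_one, map_smul, h1, smul_eq_mul, mul_one,
    sub_nonneg] at h0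
  exact_mod_cast h0

/-- A hermitian element that is not a sum of squares is separated from the sums of squares by a
positive functional. -/
theorem exists_positive_functional_of_notMem_SOS {k : ℕ} {r : Weyl n} (hr : star r = r)
    (hrk : r ∈ filtration n (2 * k)) (h : r ∉ SOS n k) :
    ∃ L : Weyl n →ₗ[ℂ] ℂ, (∀ q ∈ filtration n k, 0 ≤ L (star q * q)) ∧ (L r).re < 0 := by
  let K : ProperCone ℝ (IdxLE n (2 * k) → ℂ) :=
    ⟨(posSemidefCone (IdxLE n k)).map (gramCoef n k), isClosed_sosCone n k⟩
  obtain ⟨f, hfK, hf⟩ := K.hyperplane_separation_point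
    (x₀ := coefLE n (2 * k) r) (fun h' => h ((mem_sosCone_iff hrk).1 h'))
  let ℓ : Weyl n →ₗ[ℝ] ℝ := f.toLinearMap ∘ₗ (coefLE n (2 * k)).restrictScalars ℝ
  let starL : Weyl n →ₗ[ℝ] Weyl n :=
    { toFun := star
      map_add' := star_add
      map_smul' := fun c x => by
        rw [← Complex.coe_smul, star_smul]
        simp }
  -- The separating functional is only real-linear. Symmetrizing it under the involution makes it
  -- vanish on skew elements `I • x` with `x` hermitian, so its complex-linear extension is real on
  -- hermitian elements. The missing factor `1/2` does not affect signs.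
  let g : Module.Dual ℝ (Weyl n) := ℓ + ℓ ∘ₗ starL
  have hg : ∀ x, g x = ℓ x + ℓ (star x) := fun x => rfl
  let L : Weyl n →ₗ[ℂ] ℂ := g.extendRCLike (𝕜 := ℂ)
  have hL : ∀ x, star x = x → L x = ((ℓ x + ℓ x : ℝ) : ℂ) := by
    intro x hx
    apply Complex.ext
    · rw [Complex.ofReal_re]
      refine (Module.Dual.re_extendRCLike_apply (𝕜 := ℂ) g x).trans ?_
      rw [hg, hx]
    · rw [Complex.ofReal_im]
      refine (Module.Dual.im_extendRCLike_apply (𝕜 := ℂ) g x).trans ?_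
      rw [hg, star_smul, hx]
      simp
  have hℓr : ℓ r < 0 := hf
  refine ⟨L, fun q hq => ?_, ?_⟩
  · have hsos : star q * q ∈ SOS n k :=
      ⟨1, fun _ => q, fun _ => mem_filtration_iff.1 hq, by simp⟩
    have hnn : 0 ≤ ℓ (star q * q) :=
      hfK _ ((mem_sosCone_iff (star_mul_mem_filtration hq hq)).2 hsos)
    rw [hL _ (by simp)]
    exact_mod_cast add_nonneg hnn hnn
  · rw [hL r hr, Complex.ofReal_re]
    linarith

/-- Strong duality: the functional that separates `p - b` from the cone becomes feasible after
mixing with a state and rescaling, and its value at `p` lies below `b`. -/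
theorem exists_mem_momentValues_lt {p : Weyl n} {k : ℕ} (hp : star p = p)
    (hk : p ∈ filtration n (2 * k)) (hfeas : (sosValues p k).Nonempty) {b : ℝ}
    (hb : b ∉ sosValues p k) : ∃ y ∈ momentValues p k, y < b := by
  obtain ⟨x, hx⟩ := hfeas
  obtain ⟨Z, hZ, hpx⟩ := mem_SOS_iff.1 hx
  -- Writing `p` as a sum of squares plus the constant `x` shows that any positive functional is
  -- real at `p`.
  have hreal : ∀ L : Weyl n →ₗ[ℂ] ℂ, (∀ q ∈ filtration n k, 0 ≤ L (star q * q)) →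
      (∃ a : ℝ, 0 ≤ a ∧ L 1 = (a : ℂ)) ∧ ∃ c : ℝ, L p = (c : ℂ) := by
    intro L hL
    obtain ⟨a, ha, h1⟩ := exists_ofReal_eq_of_nonneg (by
      simpa using hL 1 (one_mem_filtration k) : 0 ≤ L 1)
    obtain ⟨c, -, hc⟩ := exists_ofReal_eq_of_nonneg (nonneg_gram hL hZ)
    refine ⟨⟨a, ha, h1.symm⟩, c + x * a, ?_⟩
    rw [← hpx, map_sub, Algebra.algebraMap_eq_smul_one, map_smul, ← h1, smul_eq_mul] at hc
    push_cast
    rw [hc]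
    ring
  have hstar : star (p - algebraMap ℂ (Weyl n) b) = p - algebraMap ℂ (Weyl n) b := by
    rw [star_sub, hp, weyl_star_algebraMap]
    simp
  obtain ⟨L, hL, hneg⟩ := exists_positive_functional_of_notMem_SOS hstar
    (sub_mem hk (algebraMap_mem_filtration _ _)) hb
  obtain ⟨⟨a, ha, hLa⟩, c, hLc⟩ := hreal L hL
  obtain ⟨L₀, h₀1, hL₀, -⟩ := exists_faithful_functional n k
  obtain ⟨-, c₀, hL₀c⟩ := hreal L₀ fun q _ => hL₀ q
  have hη : c - b * a < 0 := by
    rw [map_sub, Algebra.algebraMap_eq_smul_one, map_smul, hLa, hLc, smul_eq_mul] at hneg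
    exact_mod_cast hneg
  -- The bound on `δ` is exactly the condition that `(c + δ * c₀) / (a + δ) < b`. The positive
  -- weight `δ` is needed because `a = L 1` may be zero. The `+ 1` keeps the denominator positive
  -- when `c₀ = b`.
  obtain ⟨δ, hδ, hδη⟩ : ∃ δ : ℝ, 0 < δ ∧ δ * (c₀ - b) < b * a - c := by
    have hpos : 0 < |c₀ - b| + 1 := by positivity
    refine ⟨(b * a - c) / (|c₀ - b| + 1), div_pos (by linarith) hpos, ?_⟩
    rw [div_mul_eq_mul_div, div_lt_iff₀ hpos]
    exact mul_lt_mul_of_pos_left (by linarith [le_abs_self (c₀ - b)]) (by linarith)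
  have hs : 0 < a + δ := by linarith
  refine ⟨(a + δ)⁻¹ * (c + δ * c₀), mem_momentValues_iff.2
    ⟨((a + δ : ℝ) : ℂ)⁻¹ • (L + (δ : ℂ) • L₀), ?_, fun q hq => ?_, ?_⟩, ?_⟩
  · simp only [LinearMap.smul_apply, LinearMap.add_apply, hLa, h₀1, smul_eq_mul, mul_one]
    rw [← Complex.ofReal_add]
    exact inv_mul_cancel₀ (Complex.ofReal_ne_zero.2 hs.ne')
  · simp only [LinearMap.smul_apply, LinearMap.add_apply, smul_eq_mul]
    have h1 : (0 : ℂ) ≤ ((a + δ : ℝ) : ℂ)⁻¹ := by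
      rw [← Complex.ofReal_inv]
      exact_mod_cast (inv_pos.2 hs).le
    have h2 : (0 : ℂ) ≤ (δ : ℂ) := by exact_mod_cast hδ.le
    exact mul_nonneg h1 (add_nonneg (hL q hq) (mul_nonneg h2 (hL₀ q)))
  · simp only [LinearMap.smul_apply, LinearMap.add_apply, smul_eq_mul, hLc, hL₀c]
    push_cast
    rfl
  · rw [inv_mul_lt_iff₀ hs]
    linarith

/-- The preimage of the closed cone under a continuous affine map. This is why the supremum is
attained. -/
theorem isClosed_sosValues {p : Weyl n} {k : ℕ} (hk : p ∈ filtration n (2 * k)) :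
    IsClosed (sosValues p k) := by
  have e : sosValues p k = (fun x : ℝ => coefLE n (2 * k) p - (x : ℂ) • coefLE n (2 * k) 1) ⁻¹'
      ((posSemidefCone (IdxLE n k)).map (gramCoef n k) : Set (IdxLE n (2 * k) → ℂ)) := by
    ext x
    have h := mem_sosCone_iff (k := k) (sub_mem hk (algebraMap_mem_filtration (x : ℂ) _))
    rw [map_sub, Algebra.algebraMap_eq_smul_one, map_smul] at h
    rw [sosValues, Set.mem_ofPred_eq, Algebra.algebraMap_eq_smul_one, ← h]
    rfl
  rw [e]
  exact (isClosed_sosCone n k).preimage (by fun_prop)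

/-- The faithful state is feasible, and the representation of `p` by a sum of squares makes its
value at `p` real. Through weak duality this bounds the sum of squares values from above. -/
theorem momentValues_nonempty {p : Weyl n} {k : ℕ} (hfeas : (sosValues p k).Nonempty) :
    (momentValues p k).Nonempty := by
  obtain ⟨x, hx⟩ := hfeas
  obtain ⟨Z, hZ, hpx⟩ := mem_SOS_iff.1 hx
  obtain ⟨L, h1, hL, -⟩ := exists_faithful_functional n k
  obtain ⟨c, -, hc⟩ := exists_ofReal_eq_of_nonneg (nonneg_gram (fun q _ => hL q) hZ)
  refine ⟨c + x, mem_momentValues_iff.2 ⟨L, h1, fun q _ => hL q, ?_⟩⟩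
  rw [← hpx, map_sub, Algebra.algebraMap_eq_smul_one, map_smul, h1, smul_eq_mul, mul_one] at hc
  rw [Complex.ofReal_add, hc, sub_add_cancel]

end WeylOpt

end

/-! ### The duality theorem -/

theorem mainTheorem8 (n k : ℕ) (p : WeylOpt.Weyl n) (hp : star p = p)
    (hk : WeylOpt.deg p ≤ 2 * k)
    (hfeas : ∃ (x : ℝ) (Z : Matrix (WeylOpt.IdxLE n k) (WeylOpt.IdxLE n k) ℂ),
      WeylOpt.IsFeasibleSosSDP p k x Z) :
    ∃ v : ℝ,
      IsLUB (WeylOpt.sosValues p k) v ∧ IsGreatest (WeylOpt.sosSDPValues p k) v ∧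
      IsGLB (WeylOpt.momentValues p k) v ∧ IsGLB (WeylOpt.momentSDPValues p k) v := by
  have hkf := WeylOpt.mem_filtration_iff.2 hk
  rw [← WeylOpt.sosValues_eq_sosSDPValues, ← WeylOpt.momentValues_eq_momentSDPValues hk]
  have hne : (WeylOpt.sosValues p k).Nonempty := by
    rw [WeylOpt.sosValues_eq_sosSDPValues]
    exact hfeas
  obtain ⟨y, hy⟩ := WeylOpt.momentValues_nonempty hne
  have hbdd : BddAbove (WeylOpt.sosValues p k) :=
    ⟨y, fun x hx => WeylOpt.le_of_mem_sosValues_of_mem_momentValues hx hy⟩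
  have hmax : IsGreatest (WeylOpt.sosValues p k) (sSup (WeylOpt.sosValues p k)) :=
    (WeylOpt.isClosed_sosValues hkf).isGreatest_csSup hne hbdd
  have hglb : IsGLB (WeylOpt.momentValues p k) (sSup (WeylOpt.sosValues p k)) := by
    refine ⟨fun z hz => WeylOpt.le_of_mem_sosValues_of_mem_momentValues hmax.1 hz,
      fun b hb => ?_⟩
    by_contra hlt
    -- A lower bound `b` above the maximum is not a sum of squares value, so strong duality yields a
    -- moment value below `b`.
    obtain ⟨z, hz, hzb⟩ := WeylOpt.exists_mem_momentValues_lt hp hkf hne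
      fun hmem => hlt (hmax.2 hmem)
    exact absurd (hb hz) (not_le.2 hzb)
  exact ⟨_, hmax.isLUB, hmax, hglb, hglb⟩
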